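/- Let $(\boldsymbol X_t)_{t\in\mathbb Z}$ be a series of $\mathbb R^s$-valued random vectors on a probability space, and write $\mathbb P_T g=\frac1T\sum_{t=1}^T g(\boldsymbol X_t)$ and $Pg=\mathbb E\{g(\boldsymbol X_t)\}$. Let $\mathcal A\subseteq\mathbb R^p$, let $\mathfrak N$ be a subset of a Banach space, let $\alpha^*\in\mathcal A$, $\nu^*\in\mathfrak N$, and for $(\alpha,\nu)\in\mathcal A\times\mathfrak N$ let $\phi_{\alpha,\nu}:\mathbb R^s\to\mathbb R^r$ be measurable maps such that $P\phi_{\alpha^*,\nu^*}=0$. For $K,\delta>0$ put $\mathcal A(K)=\{\alpha\in\mathcal A:\|\alpha-\alpha^*\|\le K\}$ and $\mathfrak N(\delta)=\{\nu\in\mathfrak N:\|\nu-\nu^*\|\le\delta\}$. Let $\hat\nu=\hat\nu_T$ be an $\mathfrak N$-valued estimator of $\nu^*$, and let $\hat\alpha=\hat\alpha_T$ be an estimator which, with probability tending to one as $T\to\infty$, lies in $\mathcal A$ and solves $\mathbb P_T\phi_{\hat\alpha,\hat\nu}=0$. Suppose that $\hat\alpha$ is stochastically bounded, $\|\hat\alpha\|=O_p(1)$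 (which holds in particular if $\mathcal A$ is bounded), and that: (C1) $(\boldsymbol X_t)_{t\in\mathbb Z}$ is strictly stationary and absolutely regular, i.e. its $\beta$-mixing coefficients $\beta(n)$ tend to $0$ as $n\to\infty$, where $\beta(n)=\sup_{k\in\mathbb Z}\beta\bigl(\sigma(\boldsymbol X_t,t\le k),\sigma(\boldsymbol X_t,t\ge k+n)\bigr)$ and $\beta(\mathcal F,\mathcal G)=\sup\frac12\sum_{i}\sum_{j}|\Pr(F_i\cap G_j)-\Pr(F_i)\Pr(G_j)|$, the supremum being over all finite partitions $(F_i)$ and $(G_j)$ of the probability space into $\mathcal F$-measurable and $\mathcal G$-measurable sets, respectively. (C2) For every $\delta>0$, $\Pr(\|\hat\nu-\nu^*\|\le\delta)\to1$ as $T\to\infty$. (C3) For every $\epsilon>0$, $\inf_{\alpha\in\mathcal A,\,\|\alpha-\alpha^*\|>\epsilon}\|P\phi_{\alpha,\nu^*}\|>0$ (with $\inf\emptyset=\infty$). (C4) For every $K>0$, $P\sup_{\alpha\in\mathcal A(K)}\|\phi_{\alpha,\nu^*}\|<\infty$, and there is a $\delta>0$ such that $$P\left\{\sup_{\alpha_1,\alpha_2\in\mathcal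 A(K)}\ \sup_{\nu_1,\nu_2\in\mathfrak N(\delta)}\frac{\|\phi_{\alpha_1,\nu_1}-\phi_{\alpha_2,\nu_2}\|}{\|\alpha_1-\alpha_2\|+\|\nu_1-\nu_2\|}\right\}<\infty$$ (the supremum being over $(\alpha_1,\nu_1)\ne(\alpha_2,\nu_2)$; $P$ of a supremum that need not be measurable is an outer expectation). Then $\|\hat\alpha-\alpha^*\|=o_p(1)$, i.e. $\Pr(\|\hat\alpha-\alpha^*\|>\epsilon)\to0$ as $T\to\infty$ for every $\epsilon>0$ (outer probability if $\hat\alpha$ is not measurable). -/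

import Mathlib

open MeasureTheory ProbabilityTheory Filter Topology
open scoped ENNReal

noncomputable section

namespace SemiparametricMM

/-- Strict stationarity of a process indexed by `ℤ`: the law of the whole trajectory is
invariant under time shifts. -/
def StrictlyStationary {Ω S : Type*} [MeasurableSpace Ω] [MeasurableSpace S]
    (μ : Measure Ω) (X : ℤ → Ω → S) : Prop :=
  ∀ k : ℤ, μ.map (fun ω (t : ℤ) => X (t + k) ω) = μ.map (fun ω (t : ℤ) => X t ω)

/-- `A` is a finite partition of `Ω` into `m`-measurable sets. -/
def IsMeasPartition {Ω : Type*} (m : MeasurableSpace Ω) {n : ℕ} (A : Fin n → Set Ω) : Prop :=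
  (∀ i, MeasurableSet[m] (A i)) ∧ (∀ i j, i ≠ j → Disjoint (A i) (A j)) ∧ (⋃ i, A i) = Set.univ

/-- The absolute regularity (`β`-) dependence coefficient of two σ-algebras,
`sup (1/2) ∑ᵢ ∑ⱼ |μ (Aᵢ ∩ Bⱼ) - μ Aᵢ * μ Bⱼ|`, the supremum being over all finite partitions
`(Aᵢ)` and `(Bⱼ)` of `Ω` that are measurable for the first and the second σ-algebra. -/
def betaCoeff {Ω : Type*} [MeasurableSpace Ω] (μ : Measure Ω) (m₁ m₂ : MeasurableSpace Ω) :
    ℝ≥0∞ :=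
  ⨆ (I : ℕ) (J : ℕ) (A : Fin I → Set Ω) (B : Fin J → Set Ω)
    (_ : IsMeasPartition m₁ A) (_ : IsMeasPartition m₂ B),
    ENNReal.ofReal
      ((1 / 2 : ℝ) * ∑ i, ∑ j, |μ.real (A i ∩ B j) - μ.real (A i) * μ.real (B j)|)

/-- The σ-algebra generated by `X t`, `t ∈ s`. -/
@[reducible] def sigmaGen {Ω S : Type*} [MeasurableSpace S] (X : ℤ → Ω → S) (s : Set ℤ) :
    MeasurableSpace Ω :=
  ⨆ t ∈ s, MeasurableSpace.comap (X t) inferInstance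

/-- The `n`-th `β`-mixing coefficient of a process. -/
def betaMixing {Ω S : Type*} [MeasurableSpace Ω] [MeasurableSpace S]
    (μ : Measure Ω) (X : ℤ → Ω → S) (n : ℕ) : ℝ≥0∞ :=
  ⨆ k : ℤ, betaCoeff μ (sigmaGen X (Set.Iic k)) (sigmaGen X (Set.Ici (k + n)))

/-- Absolute regularity (`β`-mixing): the `β`-mixing coefficients tend to zero. -/
def AbsolutelyRegular {Ω S : Type*} [MeasurableSpace Ω] [MeasurableSpace S]
    (μ : Measure Ω) (X : ℤ → Ω → S) : Prop :=
  Tendsto (betaMixing μ X) atTop (𝓝 0)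

/-- Outer expectation of a nonnegative function, which need not be measurable; it equals the
Lebesgue integral if the function is measurable. -/
def outerExp {S : Type*} [MeasurableSpace S] (P : Measure S) (f : S → ℝ≥0∞) : ℝ≥0∞ :=
  ⨅ (g : S → ℝ≥0∞) (_ : Measurable g) (_ : f ≤ g), ∫⁻ x, g x ∂P

/-- The events `{ω | p T ω}` have probability tending to one. (The complements are null in the
limit for the outer measure, so no measurability of the events is needed.) -/
def WithProbTendingToOne {Ω : Type*} [MeasurableSpace Ω] (μ : Measure Ω)
    (p : ℕ → Ω → Prop) : Prop :=
  Tendsto (fun T => μ {ω | ¬ p T ω}) atTop (𝓝 0)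

/-- Stochastic boundedness `Y_T = O_p(1)`. -/
def BoundedInProb {Ω E : Type*} [MeasurableSpace Ω] [NormedAddCommGroup E] (μ : Measure Ω)
    (Y : ℕ → Ω → E) : Prop :=
  ∀ η : ℝ≥0∞, 0 < η → ∃ K : ℝ, ∀ᶠ T in atTop, μ {ω | K < ‖Y T ω‖} ≤ η

/-- `{a ∈ A : ‖a - a₀‖ ≤ δ}`. -/
def localSet {E : Type*} [NormedAddCommGroup E] (A : Set E) (a₀ : E) (δ : ℝ) : Set E :=
  {a ∈ A | ‖a - a₀‖ ≤ δ}

/-- The empirical mean `(1 / T) ∑_{t = 1}^T g (X_t)`. -/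
def empMean {Ω S F : Type*} [AddCommGroup F] [Module ℝ F] (X : ℤ → Ω → S) (T : ℕ) (ω : Ω)
    (g : S → F) : F :=
  (1 / (T : ℝ)) • ∑ t ∈ Finset.Icc 1 T, g (X (t : ℤ) ω)

/-- Identifiability: for every `ε > 0`, the infimum of `‖P φ_{α, ν*}‖` over the `α ∈ A` with
`‖α - α*‖ > ε` is positive (the infimum over the empty set being `∞`). -/
def Identifiable {S E N F : Type*} [MeasurableSpace S] [NormedAddCommGroup E]
    [NormedAddCommGroup F] [NormedSpace ℝ F]
    (P : Measure S) (A : Set E) (φ : E → N → S → F) (αs : E) (νs : N) : Prop :=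
  ∀ ε : ℝ, 0 < ε → 0 < ⨅ α ∈ {α ∈ A | ε < ‖α - αs‖}, ‖∫ x, φ α νs x ∂P‖ₑ

/-- The integrable envelope and Lipschitz condition. The quotient is `[0, ∞]`-valued, and it is
`0` where numerator and denominator vanish, so the pairs with `(α₁, ν₁) = (α₂, ν₂)` do not
contribute to the supremum. -/
def LipschitzClass {S E N F : Type*} [MeasurableSpace S] [NormedAddCommGroup E]
    [NormedAddCommGroup N] [NormedAddCommGroup F]
    (P : Measure S) (A : Set E) (V : Set N) (φ : E → N → S → F) (αs : E) (νs : N) : Prop :=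
  ∀ K : ℝ, 0 < K →
    outerExp P (fun x => ⨆ α ∈ localSet A αs K, ‖φ α νs x‖ₑ) < ∞ ∧
    ∃ δ : ℝ, 0 < δ ∧
      outerExp P (fun x =>
        ⨆ (α₁ ∈ localSet A αs K) (α₂ ∈ localSet A αs K)
          (ν₁ ∈ localSet V νs δ) (ν₂ ∈ localSet V νs δ),
          ‖φ α₁ ν₁ x - φ α₂ ν₂ x‖ₑ / (‖α₁ - α₂‖ₑ + ‖ν₁ - ν₂‖ₑ)) < ∞

end SemiparametricMM

end

/-!
Suppose that `α̂` stays at distance at least `ε` from `α*`. By stochastic boundedness `α̂` lies, up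
to small probability, in a bounded and hence totally bounded piece of the parameter set, so it is
within `ρ` of some point `β` of a finite `ρ`-net. The Lipschitz condition with integrable constant
`L` lets one pass from `P φ_{α̂, ν*}` to `P φ_{β, ν*}` at the cost `ρ * P L`, and from
`P_T φ_{β, ν*}` to `P_T φ_{α̂, ν̂} = 0` at the cost `2 ρ * P_T L`. Since `E (P_T L) ≤ P L`,
Markov's inequality bounds `P_T L` in probability, and the law of large numbers at the finitely many
points of the net makes `P_T φ_{β, ν*} - P φ_{β, ν*}` small. So `P φ_{α̂, ν*}` is smaller than the
identifiability bound, a contradiction (`enorm_integral_le_of_empMean_eq_zero` and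
`tendstoInMeasure_of_empMean_eq_zero`).

The law of large numbers holds in `L¹` (`tendsto_empDev`). For indicators it is a second moment
bound: by stationarity the covariance of `1_B(X_i)` and `1_B(X_j)` is a function of `|i - j|`, it is
at most twice the mixing coefficient at that lag, and therefore its Cesàro means tend to zero. The
functions that satisfy it form a linear space which is closed in `L¹`, because empirical means and
expectations are `L¹`-contractions (`empDev_le_add`), so it extends to all integrable functions.
-/

noncomputable section

namespace SemiparametricMM

/-! ### Marginals and covariances of a stationary absolutely regular process -/

lemma isMeasPartition_pair_compl {Ω : Type*} {m : MeasurableSpace Ω} {U : Set Ω}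
    (hU : MeasurableSet[m] U) :
    IsMeasPartition m ![U, Uᶜ] := by
  refine ⟨fun i => ?_, fun i j hij => ?_, ?_⟩
  · fin_cases i
    · exact hU
    · exact hU.compl
  · fin_cases i <;> fin_cases j <;>
      simp_all [disjoint_compl_right, disjoint_compl_left]
  · ext x
    simp [Set.mem_iUnion, Fin.exists_fin_two, em]

/-- The coefficient `betaCoeff` dominates half of each single discrepancy: test it on the
partitions `{U, Uᶜ}` and `{W, Wᶜ}`. -/
lemma half_discrepancy_le_betaCoeff {Ω : Type*} {m₁ m₂ : MeasurableSpace Ω}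
    [MeasurableSpace Ω] {μ : Measure Ω} {U W : Set Ω}
    (hU : MeasurableSet[m₁] U) (hW : MeasurableSet[m₂] W) :
    ENNReal.ofReal (1 / 2 * |μ.real (U ∩ W) - μ.real U * μ.real W|) ≤ betaCoeff μ m₁ m₂ := by
  have h : ENNReal.ofReal ((1 / 2 : ℝ) * ∑ i, ∑ j,
      |μ.real (![U, Uᶜ] i ∩ ![W, Wᶜ] j) - μ.real (![U, Uᶜ] i) * μ.real (![W, Wᶜ] j)|) ≤
      betaCoeff μ m₁ m₂ := by
    unfold betaCoeff
    refine le_iSup_of_le 2 ?_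
    refine le_iSup_of_le 2 ?_
    refine le_iSup_of_le ![U, Uᶜ] ?_
    refine le_iSup_of_le ![W, Wᶜ] ?_
    refine le_iSup_of_le (isMeasPartition_pair_compl hU) ?_
    exact le_iSup_of_le (isMeasPartition_pair_compl hW) le_rfl
  refine le_trans (ENNReal.ofReal_le_ofReal ?_) h
  simp only [Fin.sum_univ_two, Matrix.cons_val_zero, Matrix.cons_val_one]
  have h1 := abs_nonneg (μ.real (U ∩ Wᶜ) - μ.real U * μ.real Wᶜ)
  have h2 := abs_nonneg (μ.real (Uᶜ ∩ W) - μ.real Uᶜ * μ.real W)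
  have h3 := abs_nonneg (μ.real (Uᶜ ∩ Wᶜ) - μ.real Uᶜ * μ.real Wᶜ)
  linarith

section Stationary

variable {Ω S : Type*} [MeasurableSpace Ω] [MeasurableSpace S] {μ : Measure Ω} {X : ℤ → Ω → S}

/-- Strict stationarity, tested on an event of the path space. -/
lemma StrictlyStationary.measure_preimage_shift (hstat : StrictlyStationary μ X)
    (hX : ∀ t, Measurable (X t)) (k : ℤ) {C : Set (ℤ → S)} (hC : MeasurableSet C) :
    μ {ω | (fun t => X (t + k) ω) ∈ C} = μ {ω | (fun t => X t ω) ∈ C} := by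
  have h := congrArg (fun ν : Measure (ℤ → S) => ν C) (hstat k)
  beta_reduce at h
  rwa [Measure.map_apply (measurable_pi_lambda _ fun t => hX _) hC,
    Measure.map_apply (measurable_pi_lambda _ fun t => hX _) hC] at h

lemma StrictlyStationary.map_eq (hstat : StrictlyStationary μ X)
    (hX : ∀ t, Measurable (X t)) (t : ℤ) : μ.map (X t) = μ.map (X 0) := by
  ext B hB
  rw [Measure.map_apply (hX t) hB, Measure.map_apply (hX 0) hB]
  have h := hstat.measure_preimage_shift hX t (C := {x | x 0 ∈ B}) (measurable_pi_apply 0 hB)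
  simp only [Set.mem_ofPred_eq, zero_add] at h
  exact h

lemma StrictlyStationary.measure_pair (hstat : StrictlyStationary μ X)
    (hX : ∀ t, Measurable (X t)) (t n : ℤ) {B : Set S} (hB : MeasurableSet B) :
    μ (X t ⁻¹' B ∩ X (n + t) ⁻¹' B) = μ (X 0 ⁻¹' B ∩ X n ⁻¹' B) := by
  have h := hstat.measure_preimage_shift hX t (C := {x | x 0 ∈ B} ∩ {x | x n ∈ B})
    ((measurable_pi_apply 0 hB).inter (measurable_pi_apply n hB))
  simp only [Set.mem_inter_iff, Set.mem_ofPred_eq, zero_add] at h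
  exact h

/-- The covariance of the indicators of `X 0 ∈ B` and `X n ∈ B` for a stationary process; the
product of the two probabilities is written as the square of the common one. -/
def indicatorCov (μ : Measure Ω) (X : ℤ → Ω → S) (B : Set S) (n : ℕ) : ℝ :=
  μ.real (X 0 ⁻¹' B ∩ X n ⁻¹' B) - (μ.map (X 0)).real B ^ 2

lemma tendsto_abs_indicatorCov (hX : ∀ t, Measurable (X t)) (hstat : StrictlyStationary μ X)
    (hmix : AbsolutelyRegular μ X) {B : Set S} (hB : MeasurableSet B) :
    Tendsto (fun n => |indicatorCov μ X B n|) atTop (𝓝 0) := by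
  have hle : ∀ n : ℕ, ENNReal.ofReal (1 / 2 * |indicatorCov μ X B n|) ≤ betaMixing μ X n := by
    intro n
    have hU : MeasurableSet[sigmaGen X (Set.Iic 0)] (X 0 ⁻¹' B) :=
      le_iSup₂_of_le (f := fun t (_ : t ∈ Set.Iic (0 : ℤ)) =>
        MeasurableSpace.comap (X t) inferInstance) 0 (by simp) le_rfl _ ⟨B, hB, rfl⟩
    have hW : MeasurableSet[sigmaGen X (Set.Ici (0 + (n : ℤ)))] (X n ⁻¹' B) :=
      le_iSup₂_of_le (f := fun t (_ : t ∈ Set.Ici (0 + (n : ℤ))) =>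
        MeasurableSpace.comap (X t) inferInstance) (n : ℤ) (by simp) le_rfl _ ⟨B, hB, rfl⟩
    refine le_trans ?_ (le_trans (half_discrepancy_le_betaCoeff (μ := μ) hU hW)
      (le_iSup (fun k : ℤ =>
        betaCoeff μ (sigmaGen X (Set.Iic k)) (sigmaGen X (Set.Ici (k + n)))) 0))
    have h0 : μ.real (X 0 ⁻¹' B) = (μ.map (X 0)).real B := by
      rw [map_measureReal_apply (hX 0) hB]
    have hn : μ.real (X n ⁻¹' B) = (μ.map (X 0)).real B := by
      rw [← hstat.map_eq hX n, map_measureReal_apply (hX n) hB]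
    rw [h0, hn, indicatorCov, sq]
  have h1 : Tendsto (fun n => ENNReal.ofReal (1 / 2 * |indicatorCov μ X B n|)) atTop (𝓝 0) :=
    tendsto_of_tendsto_of_tendsto_of_le_of_le tendsto_const_nhds hmix (fun _ => zero_le) hle
  have h2 := (ENNReal.tendsto_toReal ENNReal.zero_ne_top).comp h1
  have h3 := h2.const_mul 2
  refine (h3.congr fun n => ?_).trans (by simp)
  rw [Function.comp_apply, ENNReal.toReal_ofReal (by positivity)]
  ring

/-! ### The law of large numbers for indicators -/

/-- `E[(1_B(X_i) - p) (1_B(X_j) - p)]` depends on `i` and `j` through `|i - j|` only, which is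
`(i - j) + (j - i)` in truncated subtraction. -/
lemma integral_centred_indicator_mul [IsProbabilityMeasure μ] (hX : ∀ t, Measurable (X t))
    (hstat : StrictlyStationary μ X) {B : Set S} (hB : MeasurableSet B) (i j : ℕ) :
    ∫ ω, (B.indicator 1 (X i ω) - (μ.map (X 0)).real B) *
      (B.indicator 1 (X j ω) - (μ.map (X 0)).real B) ∂μ =
      indicatorCov μ X B ((i - j) + (j - i)) := by
  set q := (μ.map (X 0)).real B with hq
  wlog hij : i ≤ j generalizing i j
  · rw [add_comm, ← this j i (by omega)]
    simp_rw [mul_comm]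
  obtain ⟨n, rfl⟩ := Nat.exists_eq_add_of_le hij
  have hm : ∀ t : ℤ, MeasurableSet (X t ⁻¹' B) := fun t => hX t hB
  have hmar : ∀ t : ℤ, μ.real (X t ⁻¹' B) = q := fun t => by
    rw [hq, ← hstat.map_eq hX t, map_measureReal_apply (hX t) hB]
  have hpair : μ.real (X i ⁻¹' B ∩ X (i + n : ℕ) ⁻¹' B) = μ.real (X 0 ⁻¹' B ∩ X n ⁻¹' B) := by
    have := hstat.measure_pair hX i n hB
    rw [Measure.real, Measure.real, ← this]
    push_cast
    rw [add_comm (i : ℤ)]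
  have hrw : ∀ ω, ((B.indicator 1 (X i ω) : ℝ) - q) * (B.indicator 1 (X (i + n : ℕ) ω) - q) =
      (X i ⁻¹' B ∩ X (i + n : ℕ) ⁻¹' B).indicator 1 ω - q * (X i ⁻¹' B).indicator 1 ω
        - q * (X (i + n : ℕ) ⁻¹' B).indicator 1 ω + q ^ 2 := by
    intro ω
    by_cases h1 : X i ω ∈ B <;> by_cases h2 : X (i + n : ℕ) ω ∈ B <;>
      simp only [Set.indicator, Set.mem_inter_iff, Set.mem_preimage, h1, h2, if_true, if_false,
        and_self, and_true, and_false, Pi.one_apply] <;> ring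
  have hint : ∀ {C : Set Ω}, MeasurableSet C → Integrable (C.indicator (1 : Ω → ℝ)) μ :=
    fun hC => (integrable_const (1 : ℝ)).indicator hC
  have e1 := hint ((hm i).inter (hm (i + n : ℕ)))
  have e2 := (hint (hm i)).const_mul q
  have e3 := (hint (hm (i + n : ℕ))).const_mul q
  have hidx : i - (i + n) + (i + n - i) = n := by omega
  have e12 := e1.sub e2
  have e123 := e12.sub e3
  simp only [Pi.sub_def] at e12 e123
  rw [hidx, integral_congr_ae (ae_of_all _ hrw), integral_add e123 (integrable_const _),
    integral_sub e12 e3, integral_sub e1 e2, integral_const_mul, integral_const_mul,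
    integral_indicator_one ((hm i).inter (hm _)), integral_indicator_one (hm _),
    integral_indicator_one (hm _), hpair, hmar, hmar, indicatorCov]
  simp
  ring

/-- Each distance `n < T` is attained at most twice in a row of the array `|i - j|`. -/
lemma sum_absDist_le {T : ℕ} {c : ℕ → ℝ} (hc : ∀ n, 0 ≤ c n) {i : ℕ} (hi : i ∈ Finset.Icc 1 T) :
    ∑ j ∈ Finset.Icc 1 T, c ((i - j) + (j - i)) ≤ 2 * ∑ n ∈ Finset.range T, c n := by
  rw [Finset.mem_Icc] at hi
  rw [← Finset.sum_fiberwise_of_maps_to (t := Finset.range T) (g := fun j => (i - j) + (j - i))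
    (fun j hj => by rw [Finset.mem_Icc] at hj; rw [Finset.mem_range]; omega), Finset.mul_sum]
  refine Finset.sum_le_sum fun n _ => ?_
  have hcard : (Finset.filter (fun j => (i - j) + (j - i) = n) (Finset.Icc 1 T)).card ≤ 2 := by
    refine (Finset.card_le_card (t := {i - n, i + n}) fun j hj => ?_).trans Finset.card_le_two
    rw [Finset.mem_filter] at hj
    simp only [Finset.mem_insert, Finset.mem_singleton]
    omega
  rw [Finset.sum_congr rfl (g := fun _ => c n)
    (fun j hj => by rw [(Finset.mem_filter.mp hj).2]), Finset.sum_const, nsmul_eq_mul]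
  exact mul_le_mul_of_nonneg_right (by exact_mod_cast hcard) (hc n)

lemma empMean_sub_const {Ω S F : Type*} [AddCommGroup F] [Module ℝ F] {X : ℤ → Ω → S}
    {T : ℕ} (hT : T ≠ 0) (ω : Ω) (f : S → F) (b : F) :
    empMean X T ω f - b = (1 / (T : ℝ)) • ∑ t ∈ Finset.Icc 1 T, (f (X (t : ℤ) ω) - b) := by
  rw [empMean, Finset.sum_sub_distrib, Finset.sum_const, Nat.card_Icc, Nat.add_sub_cancel, smul_sub,
    ← Nat.cast_smul_eq_nsmul ℝ T b, smul_smul, one_div_mul_cancel (Nat.cast_ne_zero.mpr hT), one_smul]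

lemma integral_sq_empMean_indicator_le [IsProbabilityMeasure μ] (hX : ∀ t, Measurable (X t))
    (hstat : StrictlyStationary μ X) {B : Set S} (hB : MeasurableSet B) {T : ℕ} (hT : T ≠ 0) :
    ∫ ω, (empMean X T ω (B.indicator (1 : S → ℝ)) - (μ.map (X 0)).real B) ^ 2 ∂μ ≤
      2 * ((T : ℝ)⁻¹ * ∑ n ∈ Finset.range T, |indicatorCov μ X B n|) := by
  set q := (μ.map (X 0)).real B with hq
  have hY : ∀ t : ℤ, Measurable fun ω => (B.indicator (1 : S → ℝ) (X t ω) - q) := fun t =>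
    ((measurable_one.indicator hB).comp (hX t)).sub_const q
  have hYb : ∀ (t : ℤ) ω, ‖B.indicator (1 : S → ℝ) (X t ω) - q‖ ≤ 1 + |q| := fun t ω => by
    refine (norm_sub_le _ _).trans (add_le_add ?_ le_rfl)
    by_cases h : X t ω ∈ B <;> simp [h]
  have hint : ∀ i j : ℤ, Integrable (fun ω => (B.indicator (1 : S → ℝ) (X i ω) - q) *
      (B.indicator (1 : S → ℝ) (X j ω) - q)) μ := fun i j =>
    Integrable.of_bound ((hY i).mul (hY j)).aestronglyMeasurable ((1 + |q|) * (1 + |q|))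
      (ae_of_all _ fun ω => by
        rw [norm_mul]
        exact mul_le_mul (hYb i ω) (hYb j ω) (norm_nonneg _) (by positivity))
  have hexp : ∀ ω, (empMean X T ω (B.indicator (1 : S → ℝ)) - q) ^ 2 =
      (1 / (T : ℝ)) ^ 2 * ∑ i ∈ Finset.Icc 1 T, ∑ j ∈ Finset.Icc 1 T,
        (B.indicator (1 : S → ℝ) (X (i : ℤ) ω) - q) *
          (B.indicator (1 : S → ℝ) (X (j : ℤ) ω) - q) := fun ω => by
    rw [empMean_sub_const hT, smul_eq_mul, mul_pow, ← Finset.sum_mul_sum, sq (∑ t ∈ _, _)]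
  simp_rw [hexp]
  rw [integral_const_mul, integral_finsetSum _ fun (i : ℕ) _ =>
    integrable_finsetSum _ fun (j : ℕ) _ => hint (i : ℤ) (j : ℤ)]
  have hij : ∀ i : ℕ, ∫ ω, ∑ j ∈ Finset.Icc 1 T, (B.indicator (1 : S → ℝ) (X (i : ℤ) ω) - q) *
      (B.indicator (1 : S → ℝ) (X (j : ℤ) ω) - q) ∂μ =
      ∑ j ∈ Finset.Icc 1 T, indicatorCov μ X B ((i - j) + (j - i)) := fun i => by
    rw [integral_finsetSum _ fun (j : ℕ) _ => hint (i : ℤ) (j : ℤ)]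
    exact Finset.sum_congr rfl fun j _ => integral_centred_indicator_mul hX hstat hB i j
  simp_rw [hij]
  have hrow : ∀ i ∈ Finset.Icc 1 T, ∑ j ∈ Finset.Icc 1 T, indicatorCov μ X B ((i - j) + (j - i)) ≤
      2 * ∑ n ∈ Finset.range T, |indicatorCov μ X B n| := fun i hi =>
    (Finset.sum_le_sum fun j _ => le_abs_self _).trans (sum_absDist_le (fun n => abs_nonneg _) hi)
  calc _ ≤ (1 / (T : ℝ)) ^ 2 * ∑ i ∈ Finset.Icc 1 T,
        2 * ∑ n ∈ Finset.range T, |indicatorCov μ X B n| := by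
        gcongr with i hi
        exact hrow i hi
    _ = _ := by
        rw [Finset.sum_const, Nat.card_Icc, Nat.add_sub_cancel, nsmul_eq_mul]
        field_simp

lemma measurable_empMean_real (hX : ∀ t, Measurable (X t)) {f : S → ℝ} (hf : Measurable f) (T : ℕ) :
    Measurable fun ω => empMean X T ω f := by
  unfold empMean
  have h := Finset.measurable_fun_sum (Finset.Icc 1 T) fun (t : ℕ) _ => hf.comp (hX (t : ℤ))
  exact h.const_mul (1 / (T : ℝ))

lemma tendsto_lintegral_empMean_indicator [IsProbabilityMeasure μ] (hX : ∀ t, Measurable (X t))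
    (hstat : StrictlyStationary μ X) (hmix : AbsolutelyRegular μ X) {B : Set S}
    (hB : MeasurableSet B) :
    Tendsto (fun T => ∫⁻ ω, ‖empMean X T ω (B.indicator (1 : S → ℝ)) - (μ.map (X 0)).real B‖ₑ ∂μ)
      atTop (𝓝 0) := by
  set q := (μ.map (X 0)).real B with hq
  have hlim : Tendsto (fun T : ℕ => ENNReal.ofReal (√(2 * ((T : ℝ)⁻¹ *
      ∑ n ∈ Finset.range T, |indicatorCov μ X B n|)))) atTop (𝓝 0) := by
    have := ENNReal.tendsto_ofReal
      (((tendsto_abs_indicatorCov hX hstat hmix hB).cesaro.const_mul 2).sqrt)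
    simpa using this
  refine tendsto_of_tendsto_of_tendsto_of_le_of_le' tendsto_const_nhds hlim
    (Eventually.of_forall fun _ => zero_le) ?_
  filter_upwards [eventually_ne_atTop 0] with T hT
  set Z := fun ω => empMean X T ω (B.indicator (1 : S → ℝ)) - q with hZ
  have hZm : Measurable Z :=
    (measurable_empMean_real hX (measurable_one.indicator hB) T).sub_const q
  have hZ1 : ∀ ω, ‖Z ω‖ ≤ 1 + |q| := fun ω => by
    refine (norm_sub_le _ _).trans (add_le_add ?_ le_rfl)
    rw [empMean, norm_smul, norm_div, norm_one, Real.norm_natCast, one_div,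
      inv_mul_le_iff₀ (by positivity)]
    refine (norm_sum_le_of_le _ (n := fun _ => (1 : ℝ)) fun t _ => ?_).trans (by simp)
    by_cases h : X t ω ∈ B <;> simp [h]
  have hZ2 : MemLp Z 2 μ := MemLp.of_bound hZm.aestronglyMeasurable _ (ae_of_all _ hZ1)
  have hA2 : MemLp (fun ω => |Z ω|) 2 μ := hZ2.abs
  have hint : Integrable (fun ω => |Z ω|) μ := hA2.integrable one_le_two
  -- `E |Z| ≤ (E Z²) ^ (1 / 2)`, since the variance of `|Z|` is nonnegative.
  have hvar := variance_nonneg (fun ω => |Z ω|) μ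
  rw [variance_eq_sub hA2] at hvar
  have hle : ∫ ω, |Z ω| ∂μ ≤ √(∫ ω, Z ω ^ 2 ∂μ) := by
    refine Real.le_sqrt_of_sq_le ?_
    have : ∫ ω, ((fun ω => |Z ω|) ^ 2) ω ∂μ = ∫ ω, Z ω ^ 2 ∂μ := by simp
    rw [this] at hvar
    linarith
  calc ∫⁻ ω, ‖Z ω‖ₑ ∂μ = ENNReal.ofReal (∫ ω, |Z ω| ∂μ) := by
        rw [ofReal_integral_eq_lintegral_ofReal hint (ae_of_all _ fun _ => abs_nonneg _)]
        simp [Real.enorm_eq_ofReal_abs]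
    _ ≤ _ := ENNReal.ofReal_le_ofReal (hle.trans (Real.sqrt_le_sqrt
        (integral_sq_empMean_indicator_le hX hstat hB hT)))

end Stationary

/-! ### Empirical means and the law of large numbers in `L¹` -/

section LawOfLargeNumbers

variable {Ω S F : Type*} [MeasurableSpace Ω] [MeasurableSpace S] {μ : Measure Ω}
  {X : ℤ → Ω → S} [NormedAddCommGroup F] [NormedSpace ℝ F]

/-- The empirical mean of a `[0, ∞]`-valued function; it is `0` for `T = 0`. -/
def empMeanENN {Ω S : Type*} (X : ℤ → Ω → S) (T : ℕ) (ω : Ω) (g : S → ℝ≥0∞) : ℝ≥0∞ :=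
  (T : ℝ≥0∞)⁻¹ * ∑ t ∈ Finset.Icc 1 T, g (X (t : ℤ) ω)

lemma enorm_empMean_le {Ω S F : Type*} [NormedAddCommGroup F] [NormedSpace ℝ F]
    {X : ℤ → Ω → S} {T : ℕ} (hT : T ≠ 0) (ω : Ω) (f : S → F) :
    ‖empMean X T ω f‖ₑ ≤ empMeanENN X T ω fun x => ‖f x‖ₑ := by
  have h : ‖(1 / (T : ℝ))‖ₑ = (T : ℝ≥0∞)⁻¹ := by
    rw [one_div, enorm_inv (Nat.cast_ne_zero.mpr hT), Real.enorm_natCast]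
  rw [empMean, empMeanENN, enorm_smul, h]
  gcongr
  exact enorm_sum_le _ _

lemma empMean_sub {Ω S F : Type*} [AddCommGroup F] [Module ℝ F] (X : ℤ → Ω → S) (T : ℕ) (ω : Ω)
    (f g : S → F) : empMean X T ω (fun x => f x - g x) = empMean X T ω f - empMean X T ω g := by
  simp only [empMean, Finset.sum_sub_distrib, smul_sub]

lemma empMeanENN_mono {Ω S : Type*} (X : ℤ → Ω → S) (T : ℕ) (ω : Ω) {g h : S → ℝ≥0∞}
    (hgh : ∀ x, g x ≤ h x) : empMeanENN X T ω g ≤ empMeanENN X T ω h := by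
  unfold empMeanENN
  gcongr
  exact hgh _

lemma empMeanENN_mul_const {Ω S : Type*} (X : ℤ → Ω → S) (T : ℕ) (ω : Ω) (g : S → ℝ≥0∞)
    (b : ℝ≥0∞) : empMeanENN X T ω (fun x => g x * b) = empMeanENN X T ω g * b := by
  simp only [empMeanENN, ← Finset.sum_mul, mul_assoc]

lemma aemeasurable_comp_of_stationary (hX : ∀ t, Measurable (X t))
    (hstat : StrictlyStationary μ X) {g : S → ℝ≥0∞} (hg : AEMeasurable g (μ.map (X 0))) (t : ℤ) :
    AEMeasurable (fun ω => g (X t ω)) μ := by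
  rw [← hstat.map_eq hX t] at hg
  exact hg.comp_measurable (hX t)

lemma aemeasurable_empMeanENN (hX : ∀ t, Measurable (X t))
    (hstat : StrictlyStationary μ X) {g : S → ℝ≥0∞} (hg : AEMeasurable g (μ.map (X 0))) (T : ℕ) :
    AEMeasurable (fun ω => empMeanENN X T ω g) μ :=
  (Finset.aemeasurable_fun_sum (Finset.Icc 1 T) fun (t : ℕ) _ =>
    aemeasurable_comp_of_stationary hX hstat hg (t : ℤ)).const_mul _

lemma lintegral_empMeanENN_le (hX : ∀ t, Measurable (X t))
    (hstat : StrictlyStationary μ X) {g : S → ℝ≥0∞} (hg : AEMeasurable g (μ.map (X 0))) (T : ℕ) :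
    ∫⁻ ω, empMeanENN X T ω g ∂μ ≤ ∫⁻ x, g x ∂(μ.map (X 0)) := by
  have hm : ∀ t : ℤ, AEMeasurable (fun ω => g (X t ω)) μ :=
    aemeasurable_comp_of_stationary hX hstat hg
  have heq : ∀ t : ℤ, ∫⁻ ω, g (X t ω) ∂μ = ∫⁻ x, g x ∂(μ.map (X 0)) := fun t => by
    rw [← hstat.map_eq hX t] at hg ⊢
    rw [lintegral_map' hg (hX t).aemeasurable]
  unfold empMeanENN
  rw [lintegral_const_mul'' _ (Finset.aemeasurable_fun_sum (Finset.Icc 1 T) fun (t : ℕ) _ => hm t),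
    lintegral_finsetSum' _ fun (t : ℕ) _ => hm t]
  simp_rw [heq]
  rw [Finset.sum_const, Nat.card_Icc, Nat.add_sub_cancel, nsmul_eq_mul, ← mul_assoc]
  exact mul_le_of_le_one_left zero_le (ENNReal.inv_mul_le_one _)

lemma aestronglyMeasurable_empMean (hX : ∀ t, Measurable (X t))
    (hstat : StrictlyStationary μ X) {f : S → F} (hf : AEStronglyMeasurable f (μ.map (X 0)))
    (T : ℕ) : AEStronglyMeasurable (fun ω => empMean X T ω f) μ := by
  have h : ∀ t : ℤ, AEStronglyMeasurable (fun ω => f (X t ω)) μ := fun t => by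
    rw [← hstat.map_eq hX t] at hf
    exact hf.comp_measurable (hX t)
  exact (Finset.aestronglyMeasurable_fun_sum (Finset.Icc 1 T) fun (t : ℕ) _ =>
    h (t : ℤ)).const_smul (1 / (T : ℝ))

lemma aemeasurable_enorm_empMean_sub (hX : ∀ t, Measurable (X t))
    (hstat : StrictlyStationary μ X) {f : S → F} (hf : AEStronglyMeasurable f (μ.map (X 0)))
    (T : ℕ) (b : F) : AEMeasurable (fun ω => ‖empMean X T ω f - b‖ₑ) μ :=
  ((aestronglyMeasurable_empMean hX hstat hf T).sub aestronglyMeasurable_const).enorm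

/-- The `L¹` distance between the empirical mean of `f` and its expectation. -/
def empDev (μ : Measure Ω) (X : ℤ → Ω → S) (f : S → F) (T : ℕ) : ℝ≥0∞ :=
  ∫⁻ ω, ‖empMean X T ω f - ∫ x, f x ∂(μ.map (X 0))‖ₑ ∂μ

/-- Empirical means and expectations are both `L¹`-contractions, whence the factor `2`. -/
lemma empDev_le_add [IsProbabilityMeasure μ] (hX : ∀ t, Measurable (X t))
    (hstat : StrictlyStationary μ X) {f g : S → F} (hf : Integrable f (μ.map (X 0)))
    (hg : Integrable g (μ.map (X 0))) {T : ℕ} (hT : T ≠ 0) :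
    empDev μ X f T ≤ empDev μ X g T + 2 * ∫⁻ x, ‖f x - g x‖ₑ ∂(μ.map (X 0)) := by
  set P := μ.map (X 0)
  have hfg : AEMeasurable (fun x => ‖f x - g x‖ₑ) P := (hf.sub hg).aestronglyMeasurable.enorm
  have hpt : ∀ ω, ‖empMean X T ω f - ∫ x, f x ∂P‖ₑ ≤
      ‖empMean X T ω g - ∫ x, g x ∂P‖ₑ +
        (empMeanENN X T ω (fun x => ‖f x - g x‖ₑ) + ∫⁻ x, ‖f x - g x‖ₑ ∂P) := fun ω => by
    have h : empMean X T ω f - ∫ x, f x ∂P = (empMean X T ω g - ∫ x, g x ∂P) +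
        (empMean X T ω (fun x => f x - g x) - ∫ x, (f x - g x) ∂P) := by
      rw [empMean_sub, integral_sub hf hg]
      abel
    rw [h]
    refine (enorm_add_le _ _).trans (add_le_add le_rfl (enorm_sub_le.trans (add_le_add ?_ ?_)))
    · exact enorm_empMean_le hT _ _
    · exact enorm_integral_le_lintegral_enorm _
  calc empDev μ X f T ≤ ∫⁻ ω, (‖empMean X T ω g - ∫ x, g x ∂P‖ₑ +
        (empMeanENN X T ω (fun x => ‖f x - g x‖ₑ) + ∫⁻ x, ‖f x - g x‖ₑ ∂P)) ∂μ :=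
        lintegral_mono hpt
    _ = empDev μ X g T + (∫⁻ ω, empMeanENN X T ω (fun x => ‖f x - g x‖ₑ) ∂μ +
        ∫⁻ x, ‖f x - g x‖ₑ ∂P) := by
        rw [lintegral_add_left' (aemeasurable_enorm_empMean_sub hX hstat hg.aestronglyMeasurable T _),
          lintegral_add_right' _ aemeasurable_const, lintegral_const, measure_univ, mul_one, empDev]
    _ ≤ _ := by
        rw [two_mul]
        gcongr
        exact lintegral_empMeanENN_le hX hstat hfg T

/-- The set of functions that satisfy the law of large numbers is closed in `L¹`. -/
lemma tendsto_empDev_of_approx [IsProbabilityMeasure μ] (hX : ∀ t, Measurable (X t))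
    (hstat : StrictlyStationary μ X) {f : S → F} (hf : Integrable f (μ.map (X 0)))
    (happ : ∀ ε : ℝ≥0∞, 0 < ε → ∃ g : S → F, Integrable g (μ.map (X 0)) ∧
      Tendsto (empDev μ X g) atTop (𝓝 0) ∧ ∫⁻ x, ‖f x - g x‖ₑ ∂(μ.map (X 0)) ≤ ε) :
    Tendsto (empDev μ X f) atTop (𝓝 0) := by
  rw [ENNReal.tendsto_nhds_zero]
  intro ε hε
  obtain ⟨g, hg, hgt, hle⟩ := happ (ε / 2 / 2) (by simp [hε.ne'])
  filter_upwards [ENNReal.tendsto_nhds_zero.mp hgt (ε / 2) (by simp [hε.ne']),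
    eventually_ne_atTop 0] with T h1 hT
  calc empDev μ X f T ≤ empDev μ X g T + 2 * ∫⁻ x, ‖f x - g x‖ₑ ∂(μ.map (X 0)) :=
        empDev_le_add hX hstat hf hg hT
    _ ≤ ε / 2 + 2 * (ε / 2 / 2) := by gcongr
    _ = ε := by
        rw [ENNReal.mul_div_cancel two_ne_zero ENNReal.ofNat_ne_top, ENNReal.add_halves]

/-- The law of large numbers in `L¹` for a stationary absolutely regular process: the class of
integrable functions for which it holds contains the indicators and is a closed subspace. -/
theorem tendsto_empDev [IsProbabilityMeasure μ] [CompleteSpace F] (hX : ∀ t, Measurable (X t))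
    (hstat : StrictlyStationary μ X) (hmix : AbsolutelyRegular μ X) {f : S → F}
    (hf : Integrable f (μ.map (X 0))) : Tendsto (empDev μ X f) atTop (𝓝 0) := by
  have hP : IsProbabilityMeasure (μ.map (X 0)) := Measure.isProbabilityMeasure_map (hX 0).aemeasurable
  refine Integrable.induction (fun f => Tendsto (empDev μ X f) atTop (𝓝 0)) ?_ ?_ ?_ ?_ hf
  · intro c B hB _
    have h := ENNReal.Tendsto.mul_const (b := ‖c‖ₑ)
      (tendsto_lintegral_empMean_indicator hX hstat hmix hB) (Or.inr enorm_ne_top)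
    rw [zero_mul] at h
    refine h.congr fun T => ?_
    rw [← lintegral_mul_const' _ _ enorm_ne_top, empDev]
    refine lintegral_congr fun ω => ?_
    rw [← enorm_smul, sub_smul, integral_indicator_const c hB]
    congr 2
    rw [empMean, empMean, smul_assoc, Finset.sum_smul]
    congr 1
    refine Finset.sum_congr rfl fun t _ => ?_
    by_cases hx : X t ω ∈ B <;> simp [hx]
  · intro f g _ hf hg hft hgt
    have h := hft.add hgt
    rw [add_zero] at h
    refine tendsto_of_tendsto_of_tendsto_of_le_of_le tendsto_const_nhds h (fun _ => zero_le)
      fun T => ?_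
    simp only [empDev]
    rw [← lintegral_add_left' (aemeasurable_enorm_empMean_sub hX hstat hf.aestronglyMeasurable T _)]
    refine lintegral_mono fun ω => ?_
    rw [integral_add' hf hg]
    refine le_trans (le_of_eq ?_) (enorm_add_le _ _)
    congr 1
    simp only [empMean, Pi.add_apply, Finset.sum_add_distrib, smul_add]
    abel
  · refine isClosed_of_closure_subset fun f hf => ?_
    refine tendsto_empDev_of_approx hX hstat (L1.integrable_coeFn f) fun ε hε => ?_
    obtain ⟨g, hg, hfg⟩ := EMetric.mem_closure_iff.mp hf ε hε
    refine ⟨g, L1.integrable_coeFn g, hg, ?_⟩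
    rw [Lp.edist_def, eLpNorm_one_eq_lintegral_enorm] at hfg
    exact hfg.le
  · intro f g hfg hf hft
    refine tendsto_empDev_of_approx hX hstat (hf.congr hfg) fun ε hε => ⟨f, hf, hft, ?_⟩
    have h0 : ∫⁻ x, ‖g x - f x‖ₑ ∂(μ.map (X 0)) = 0 := by
      rw [← lintegral_zero (μ := μ.map (X 0))]
      refine lintegral_congr_ae ?_
      filter_upwards [hfg] with x hx
      simp [hx]
    rw [h0]
    exact zero_le

lemma tendsto_measure_empMean_dev [IsProbabilityMeasure μ] [CompleteSpace F]
    (hX : ∀ t, Measurable (X t)) (hstat : StrictlyStationary μ X) (hmix : AbsolutelyRegular μ X)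
    {f : S → F} (hf : Integrable f (μ.map (X 0))) {c : ℝ≥0∞} (hc : c ≠ 0) (hc' : c ≠ ∞) :
    Tendsto (fun T => μ {ω | c ≤ ‖empMean X T ω f - ∫ x, f x ∂(μ.map (X 0))‖ₑ}) atTop (𝓝 0) := by
  have h := ENNReal.Tendsto.div_const (tendsto_empDev hX hstat hmix hf) (Or.inr hc)
  rw [ENNReal.zero_div] at h
  exact tendsto_of_tendsto_of_tendsto_of_le_of_le tendsto_const_nhds h (fun _ => zero_le)
    fun T => meas_ge_le_lintegral_div (aemeasurable_enorm_empMean_sub hX hstat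
      hf.aestronglyMeasurable T _) hc hc'

end LawOfLargeNumbers

/-! ### Consistency -/

section Consistency

/-- The deterministic core of the consistency proof: if `P_T φ_{α, ν} = 0` with `ν` near `ν*` and
`α` near a point `β` of the net, then `P φ_{α, ν*}` is small as soon as the law of large numbers
is effective at `β` and the empirical mean of the Lipschitz constant `L` is under control. -/
lemma enorm_integral_le_of_empMean_eq_zero {Ω S E N F : Type*} [MeasurableSpace S]
    [NormedAddCommGroup F] [NormedSpace ℝ F] {X : ℤ → Ω → S} {P : Measure S} {φ : E → N → S → F}
    {νs : N} {β α : E} {ν : N} {L : S → ℝ≥0∞} {ρ : ℝ≥0∞}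
    (hα : Integrable (φ α νs) P) (hβ : Integrable (φ β νs) P)
    (h₀ : ∀ x, ‖φ α νs x - φ β νs x‖ₑ ≤ L x * ρ)
    (h₁ : ∀ x, ‖φ β νs x - φ α ν x‖ₑ ≤ L x * (2 * ρ)) (hL : Measurable L)
    {T : ℕ} (hT : T ≠ 0) {ω : Ω} (hzero : empMean X T ω (φ α ν) = 0) :
    ‖∫ x, φ α νs x ∂P‖ₑ ≤ ρ * ((∫⁻ x, L x ∂P) + 2 * empMeanENN X T ω L) +
      ‖empMean X T ω (φ β νs) - ∫ x, φ β νs x ∂P‖ₑ := by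
  have hdec : ∫ x, φ α νs x ∂P = (∫ x, (φ α νs x - φ β νs x) ∂P +
      empMean X T ω (fun x => φ β νs x - φ α ν x)) -
      (empMean X T ω (φ β νs) - ∫ x, φ β νs x ∂P) := by
    rw [empMean_sub, hzero, integral_sub hα hβ]
    abel
  have e₀ : ‖∫ x, (φ α νs x - φ β νs x) ∂P‖ₑ ≤ (∫⁻ x, L x ∂P) * ρ := by
    rw [← lintegral_mul_const _ hL]
    exact (enorm_integral_le_lintegral_enorm _).trans (lintegral_mono h₀)
  have e₁ : ‖empMean X T ω (fun x => φ β νs x - φ α ν x)‖ₑ ≤ empMeanENN X T ω L * (2 * ρ) := by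
    rw [← empMeanENN_mul_const]
    exact (enorm_empMean_le hT _ _).trans (empMeanENN_mono X T ω h₁)
  rw [hdec]
  refine enorm_sub_le.trans (add_le_add ((enorm_add_le _ _).trans ((add_le_add e₀ e₁).trans ?_))
    le_rfl)
  exact le_of_eq (by ring)

variable {Ω S E N F : Type*} [MeasurableSpace Ω] [MeasurableSpace S] {μ : Measure Ω}
  {X : ℤ → Ω → S} [NormedAddCommGroup E] [NormedAddCommGroup N] [NormedAddCommGroup F]
  {P : Measure S} {A : Set E} {V : Set N} {φ : E → N → S → F} {αs : E} {νs : N}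

lemma exists_measurable_majorant {f : S → ℝ≥0∞} (h : outerExp P f < ∞) :
    ∃ g : S → ℝ≥0∞, Measurable g ∧ f ≤ g ∧ ∫⁻ x, g x ∂P < ∞ := by
  simp only [outerExp, iInf_lt_iff] at h
  obtain ⟨g, hg, hfg, hlt⟩ := h
  exact ⟨g, hg, hfg, hlt⟩

lemma LipschitzClass.exists_envelope (h : LipschitzClass P A V φ αs νs) {K : ℝ} (hK : 0 < K) :
    ∃ g : S → ℝ≥0∞, Measurable g ∧ ∫⁻ x, g x ∂P < ∞ ∧
      ∀ α ∈ localSet A αs K, ∀ x, ‖φ α νs x‖ₑ ≤ g x := by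
  obtain ⟨g, hg, hfg, hlt⟩ := exists_measurable_majorant (h K hK).1
  exact ⟨g, hg, hlt, fun α hα x =>
    (le_iSup₂ (f := fun α (_ : α ∈ localSet A αs K) => ‖φ α νs x‖ₑ) α hα).trans (hfg x)⟩

lemma LipschitzClass.exists_lipschitz (h : LipschitzClass P A V φ αs νs) {K : ℝ} (hK : 0 < K) :
    ∃ δ : ℝ, 0 < δ ∧ ∃ L : S → ℝ≥0∞, Measurable L ∧ ∫⁻ x, L x ∂P < ∞ ∧
      ∀ α₁ ∈ localSet A αs K, ∀ α₂ ∈ localSet A αs K, ∀ ν₁ ∈ localSet V νs δ,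
        ∀ ν₂ ∈ localSet V νs δ, ∀ x,
          ‖φ α₁ ν₁ x - φ α₂ ν₂ x‖ₑ ≤ L x * (‖α₁ - α₂‖ₑ + ‖ν₁ - ν₂‖ₑ) := by
  obtain ⟨δ, hδ, hout⟩ := (h K hK).2
  obtain ⟨L, hL, hfL, hlt⟩ := exists_measurable_majorant hout
  refine ⟨δ, hδ, L, hL, hlt, fun α₁ h1 α₂ h2 ν₁ h3 ν₂ h4 x => ?_⟩
  have hq : ‖φ α₁ ν₁ x - φ α₂ ν₂ x‖ₑ / (‖α₁ - α₂‖ₑ + ‖ν₁ - ν₂‖ₑ) ≤ L x := by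
    refine le_trans ?_ (hfL x)
    refine le_iSup₂_of_le α₁ h1 ?_
    refine le_iSup₂_of_le α₂ h2 ?_
    refine le_iSup₂_of_le ν₁ h3 ?_
    exact le_iSup₂_of_le ν₂ h4 le_rfl
  by_cases h0 : ‖α₁ - α₂‖ₑ + ‖ν₁ - ν₂‖ₑ = 0
  · rw [add_eq_zero, enorm_eq_zero, enorm_eq_zero, sub_eq_zero, sub_eq_zero] at h0
    rw [h0.1, h0.2, sub_self, enorm_zero]
    exact zero_le
  · exact (ENNReal.div_le_iff_le_mul (Or.inl h0)
      (Or.inl (ENNReal.add_ne_top.mpr ⟨enorm_ne_top, enorm_ne_top⟩))).mp hq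

lemma LipschitzClass.integrable (h : LipschitzClass P A V φ αs νs)
    (hφ : ∀ α ∈ A, AEStronglyMeasurable (φ α νs) P) {α : E} (hα : α ∈ A) :
    Integrable (φ α νs) P := by
  obtain ⟨g, -, hlt, hle⟩ := h.exists_envelope (K := ‖α - αs‖ + 1) (by positivity)
  refine ⟨hφ α hα, ?_⟩
  exact (lintegral_mono (hle α ⟨hα, by linarith⟩)).trans_lt hlt

/-- Consistency of zeros of the empirical means, for a parameter in a proper normed
space and identifying functions with values in a Banach space. -/
theorem tendstoInMeasure_of_empMean_eq_zero [IsProbabilityMeasure μ] [ProperSpace E]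
    [NormedSpace ℝ F] [CompleteSpace F] (hX : ∀ t, Measurable (X t)) (hνs : νs ∈ V)
    (hφ : ∀ α ∈ A, AEStronglyMeasurable (φ α νs) (μ.map (X 0)))
    {νhat : ℕ → Ω → N} (hνhat : ∀ T ω, νhat T ω ∈ V) {αhat : ℕ → Ω → E}
    (hαhat : WithProbTendingToOne μ fun T ω =>
      αhat T ω ∈ A ∧ empMean X T ω (φ (αhat T ω) (νhat T ω)) = 0)
    (hbdd : BoundedInProb μ αhat) (hstat : StrictlyStationary μ X) (hmix : AbsolutelyRegular μ X)
    (hcons : ∀ δ : ℝ, 0 < δ → WithProbTendingToOne μ fun T ω => ‖νhat T ω - νs‖ ≤ δ)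
    (hident : Identifiable (μ.map (X 0)) A φ αs νs)
    (hlip : LipschitzClass (μ.map (X 0)) A V φ αs νs) :
    TendstoInMeasure μ αhat atTop fun _ => αs := by
  rw [tendstoInMeasure_iff_norm]
  intro ε hε
  rw [ENNReal.tendsto_nhds_zero]
  intro η hη
  set P := μ.map (X 0)
  -- The identifiability bound may be `∞`; it is cut off at `1` so that Markov's inequality applies.
  obtain ⟨c, hc, hc1, hcle⟩ : ∃ c : ℝ≥0∞, c ≠ 0 ∧ c ≠ ∞ ∧
      ∀ α ∈ A, ε ≤ ‖α - αs‖ → c ≤ ‖∫ x, φ α νs x ∂P‖ₑ := by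
    have h := hident (ε / 2) (half_pos hε)
    refine ⟨min 1 _, (lt_min one_pos h).ne', ne_top_of_le_ne_top ENNReal.one_ne_top (min_le_left _ _),
      fun α hα hle => (min_le_right _ _).trans ?_⟩
    exact iInf₂_le (f := fun α (_ : α ∈ {α ∈ A | ε / 2 < ‖α - αs‖}) => ‖∫ x, φ α νs x ∂P‖ₑ) α
      ⟨hα, by linarith⟩
  have hη5 : 0 < η / 5 := ENNReal.div_pos hη.ne' (by simp)
  obtain ⟨K₀, hK₀⟩ := hbdd (η / 5) hη5
  set K : ℝ := |K₀| + ‖αs‖ + 1 with hK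
  have hKpos : 0 < K := by positivity
  obtain ⟨δ, hδ, L, hL, hLint, hLle⟩ := hlip.exists_lipschitz hKpos
  set I := ∫⁻ x, L x ∂P
  -- By Markov's inequality, `P_T L` exceeds `M` with probability at most `η / 5`.
  set M := I / (η / 5) + 1 with hM
  have hMtop : M ≠ ∞ := ENNReal.add_ne_top.mpr
    ⟨ENNReal.div_ne_top hLint.ne hη5.ne', ENNReal.one_ne_top⟩
  have hMpos : M ≠ 0 := by simp [hM]
  have hIM : I / M ≤ η / 5 := by
    by_cases htop : η / 5 = ∞
    · rw [htop]
      exact le_top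
    · refine ENNReal.div_le_of_le_mul ?_
      rw [hM, mul_add, ENNReal.mul_div_cancel hη5.ne' htop]
      exact le_self_add
  -- The mesh `ρ` of the net makes the Lipschitz errors less than `c / 2` altogether.
  obtain ⟨ρ, hρ, hρlt⟩ := ENNReal.exists_nnreal_pos_mul_lt (a := I + 2 * M) (b := c / 2)
    (by simp [hLint.ne, hMtop, ENNReal.mul_eq_top]) (by simp [hc])
  have hρ' : (0 : ℝ) < ρ := hρ
  have htb : TotallyBounded (localSet A αs K) :=
    (isCompact_closedBall αs K).totallyBounded.subset fun α hα => by
      rw [mem_closedBall_iff_norm]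
      exact hα.2
  obtain ⟨t, htA, htfin, htcov⟩ := Metric.finite_approx_of_totallyBounded htb ρ hρ'
  have hnet : Tendsto (fun T => ∑ β ∈ htfin.toFinset,
      μ {ω | c / 2 ≤ ‖empMean X T ω (φ β νs) - ∫ x, φ β νs x ∂P‖ₑ}) atTop (𝓝 0) := by
    have h := tendsto_finsetSum htfin.toFinset fun β hβ => tendsto_measure_empMean_dev hX hstat hmix
      (hlip.integrable hφ (htA (htfin.mem_toFinset.mp hβ)).1) (by simp [hc])
      (c := c / 2) (ENNReal.div_ne_top hc1 two_ne_zero)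
    simpa only [Finset.sum_const_zero] using h
  filter_upwards [ENNReal.tendsto_nhds_zero.mp hαhat (η / 5) hη5, hK₀,
    ENNReal.tendsto_nhds_zero.mp (hcons (min δ ρ) (lt_min hδ hρ')) (η / 5) hη5,
    ENNReal.tendsto_nhds_zero.mp hnet (η / 5) hη5, eventually_ne_atTop 0] with T g1 g2 g3 g4 hT
  have g5 : μ {ω | M ≤ empMeanENN X T ω L} ≤ η / 5 :=
    (meas_ge_le_lintegral_div (aemeasurable_empMeanENN hX hstat hL.aemeasurable T) hMpos
      hMtop).trans ((ENNReal.div_le_div_right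
        (lintegral_empMeanENN_le hX hstat hL.aemeasurable T) M).trans hIM)
  -- Outside the five exceptional events `‖P φ_{α̂, ν*}‖ < c`, which contradicts identifiability.
  have hsub : {ω | ε ≤ ‖αhat T ω - αs‖} ⊆
      {ω | ¬ (αhat T ω ∈ A ∧ empMean X T ω (φ (αhat T ω) (νhat T ω)) = 0)} ∪
      ({ω | K₀ < ‖αhat T ω‖} ∪ ({ω | ¬ ‖νhat T ω - νs‖ ≤ min δ ρ} ∪
      ({ω | M ≤ empMeanENN X T ω L} ∪ ⋃ β ∈ htfin.toFinset,
        {ω | c / 2 ≤ ‖empMean X T ω (φ β νs) - ∫ x, φ β νs x ∂P‖ₑ}))) := by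
    intro ω hω
    by_contra hcon
    simp only [Set.mem_union, Set.mem_ofPred_eq, not_or, not_not, not_lt, not_le, Set.mem_iUnion,
      not_exists] at hcon
    obtain ⟨⟨hαA, hz⟩, hαK, hν, hML, hdev⟩ := hcon
    have hαloc : αhat T ω ∈ localSet A αs K := by
      refine ⟨hαA, (norm_sub_le _ _).trans ?_⟩
      have := le_abs_self K₀
      linarith
    obtain ⟨β, hβt, hβ⟩ := Set.mem_iUnion₂.mp (htcov hαloc)
    rw [Metric.mem_ball, dist_eq_norm] at hβ
    have hβloc := htA hβt
    have hν₀ : νs ∈ localSet V νs δ := ⟨hνs, by simpa using hδ.le⟩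
    have hν₁ : νhat T ω ∈ localSet V νs δ := ⟨hνhat T ω, hν.trans (min_le_left _ _)⟩
    have hαβ : ‖αhat T ω - β‖ₑ ≤ ρ := enorm_le_coe.mpr hβ.le
    have hνν : ‖νhat T ω - νs‖ₑ ≤ ρ := enorm_le_coe.mpr (hν.trans (min_le_right _ _))
    have hmain := enorm_integral_le_of_empMean_eq_zero (P := P) (ρ := ρ)
      (hlip.integrable hφ hαA) (hlip.integrable hφ hβloc.1)
      (fun x => (hLle _ hαloc β hβloc νs hν₀ νs hν₀ x).trans (by
        rw [sub_self, enorm_zero, add_zero]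
        gcongr))
      (fun x => (hLle β hβloc _ hαloc νs hν₀ _ hν₁ x).trans (by
        rw [enorm_sub_rev β, enorm_sub_rev νs, two_mul]
        gcongr)) hL hT hz
    have hlt : ‖∫ x, φ (αhat T ω) νs x ∂P‖ₑ < c / 2 + c / 2 := by
      refine hmain.trans_lt (ENNReal.add_lt_add (lt_of_le_of_lt ?_ hρlt)
        (hdev β (htfin.mem_toFinset.mpr hβt)))
      gcongr
    rw [ENNReal.add_halves] at hlt
    exact hlt.not_ge (hcle _ hαA hω)
  calc μ {ω | ε ≤ ‖αhat T ω - αs‖}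
      ≤ η / 5 + (η / 5 + (η / 5 + (η / 5 + η / 5))) := by
        refine (measure_mono hsub).trans ((measure_union_le _ _).trans (add_le_add g1 ?_))
        refine (measure_union_le _ _).trans (add_le_add g2 ?_)
        refine (measure_union_le _ _).trans (add_le_add g3 ?_)
        refine (measure_union_le _ _).trans (add_le_add g5 ?_)
        exact (measure_biUnion_finset_le _ _).trans g4
    _ = 5 * (η / 5) := by ring
    _ = η := ENNReal.mul_div_cancel (by simp) (by simp)

end Consistency

end SemiparametricMM

end

theorem mainTheorem5
    {Ω : Type*} [MeasurableSpace Ω] (μ : Measure Ω) [IsProbabilityMeasure μ]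
    {N : Type*} [NormedAddCommGroup N] [NormedSpace ℝ N] [CompleteSpace N]
    (p r s : ℕ)
    -- the series
    (X : ℤ → Ω → EuclideanSpace ℝ (Fin s)) (hX : ∀ t, Measurable (X t))
    -- parameter sets, true values and identifying functions
    (A : Set (EuclideanSpace ℝ (Fin p))) (αs : EuclideanSpace ℝ (Fin p)) (hαs : αs ∈ A)
    (V : Set N) (νs : N) (hνs : νs ∈ V)
    (φ : EuclideanSpace ℝ (Fin p) → N → EuclideanSpace ℝ (Fin s) → EuclideanSpace ℝ (Fin r))
    (hφ : ∀ α ∈ A, ∀ ν ∈ V, Measurable (φ α ν))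
    (hzero : ∫ x, φ αs νs x ∂(μ.map (X 0)) = 0)
    -- the estimators
    (νhat : ℕ → Ω → N) (hνhat : ∀ T ω, νhat T ω ∈ V)
    (αhat : ℕ → Ω → EuclideanSpace ℝ (Fin p))
    (hαhat : SemiparametricMM.WithProbTendingToOne μ (fun T ω =>
      αhat T ω ∈ A ∧ SemiparametricMM.empMean X T ω (φ (αhat T ω) (νhat T ω)) = 0))
    (hbdd : SemiparametricMM.BoundedInProb μ αhat)
    -- stationarity and mixing
    (hstat : SemiparametricMM.StrictlyStationary μ X)
    (hmix : SemiparametricMM.AbsolutelyRegular μ X)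
    -- consistency of the nuisance estimator
    (hcons : ∀ δ : ℝ, 0 < δ →
      SemiparametricMM.WithProbTendingToOne μ (fun T ω => ‖νhat T ω - νs‖ ≤ δ))
    -- identifiability
    (hident : SemiparametricMM.Identifiable (μ.map (X 0)) A φ αs νs)
    -- envelope and Lipschitz condition
    (hlip : SemiparametricMM.LipschitzClass (μ.map (X 0)) A V φ αs νs) :
    TendstoInMeasure μ αhat atTop (fun _ => αs) := by
  exact SemiparametricMM.tendstoInMeasure_of_empMean_eq_zero hX hνs
    (fun α hα => (hφ α hα νs hνs).aestronglyMeasurable) hνhat hαhat hbdd hstat hmix hcons hident hlip
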